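/- **Theorem (Convergence of Random Osborne).** Let $K\in\mathbb{R}_{\ge 0}^{n\times n}$ be a nonzero nonnegative matrix which is balanceable, i.e. there is $x\in\mathbb{R}^n$ such that $A=\operatorname{diag}(e^{x})K\operatorname{diag}(e^{-x})$ has row sums $r(A)$ equal to its column sums $c(A)$, and let $\varepsilon>0$. Let $m$ be the number of nonzero entries of $K$, let $\kappa=\big(\sum_{i,j}K_{ij}\big)/\min\{K_{ij}:K_{ij}>0\}$, and let $d\in\mathbb{N}\cup\{\infty\}$ be the diameter (largest directed distance) of the directed graph on $\{1,\dots,n\}$ with an edge $(i,j)$ whenever $K_{ij}>0$, where $\tfrac1\varepsilon\wedge\infty=\tfrac1\varepsilon$. Random Osborne starts at $x=\mathbf 0$ and, as long as $A=\operatorname{diag}(e^{x})K\operatorname{diag}(e^{-x})$ is not $\varepsilon$-balanced, i.e. as long as $\|r(A)-c(A)\|_1>\varepsilon\sum_{i,j}A_{ij}$, draws a coordinate $k$ uniformly from $\{1,\dots,n\}$, independently between iterations, and performs the Osborne update $$x_k\gets x_k+\tfrac12\big(\log c_k(A)-\log r_k(A)\big);$$ it then returns $x$. (If the $k$-th row and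 column of $K$ are zero, $x_k$ is left unchanged, at no cost.) Let $T$ be the total number of exact arithmetic operations ($+,-,\times,/,\exp,\log$ of real numbers) that are performed by the updates until the algorithm stops, where $r_k(A)$ and $c_k(A)$ are computed in each update from the nonzero entries in the $k$-th row and column of $K$. Then the algorithm stops almost surely, and its output $x$ solves $\mathrm{ABAL}(K,\varepsilon)$, i.e. $\operatorname{diag}(e^{x})K\operatorname{diag}(e^{-x})$ is $\varepsilon$-balanced. Moreover, there is a universal constant $C>0$, independent of $n$, $K$, $\varepsilon$ and $\delta$, such that: - (Expectation guarantee.) $\displaystyle \mathbb{E}[T]\le C\,\frac m\varepsilon\Big(\frac1\varepsilon\wedge d\Big)\log\kappa .$ - (High probability guarantee.) For all $\delta>0$, $$\mathbb{P}\Big(T\le C\,\frac m\varepsilon\Big(\frac1\varepsilon\wedge d\Big)\log\kappa\cdot\max\{1,\log\tfrac1\delta\}\Big)\ge 1-\delta .$$ -/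

import Mathlib

open MeasureTheory ProbabilityTheory
open scoped ENNReal

noncomputable section

namespace Osborne

/-! ### Matrix balancing -/

section Balancing

variable {n : ℕ}

/-- The vector `r(A)` of row sums. -/
def rowSum (A : Matrix (Fin n) (Fin n) ℝ) (i : Fin n) : ℝ := ∑ j, A i j

/-- The vector `c(A)` of column sums. -/
def colSum (A : Matrix (Fin n) (Fin n) ℝ) (j : Fin n) : ℝ := ∑ i, A i j

/-- `A` is balanced: `r(A) = c(A)`. -/
def IsBalanced (A : Matrix (Fin n) (Fin n) ℝ) : Prop := rowSum A = colSum A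

/-- `A` is `ε`-balanced: `‖r(A) - c(A)‖₁ / ∑ i j, A i j ≤ ε`. -/
def IsEpsBalanced (ε : ℝ) (A : Matrix (Fin n) (Fin n) ℝ) : Prop :=
  (∑ i, |rowSum A i - colSum A i|) / (∑ i, ∑ j, A i j) ≤ ε

/-- The scaling `diag(e^x) K diag(e^{-x})`. -/
def scaling (K : Matrix (Fin n) (Fin n) ℝ) (x : Fin n → ℝ) : Matrix (Fin n) (Fin n) ℝ :=
  Matrix.diagonal (fun i => Real.exp (x i)) * K * Matrix.diagonal (fun i => Real.exp (-x i))

/-- `K` is balanceable: some scaling `diag(e^x) K diag(e^{-x})` is balanced. -/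
def Balanceable (K : Matrix (Fin n) (Fin n) ℝ) : Prop := ∃ x, IsBalanced (scaling K x)

/-- `x` solves the approximate balancing problem `ABAL(K, ε)`. -/
def SolvesABAL (K : Matrix (Fin n) (Fin n) ℝ) (ε : ℝ) (x : Fin n → ℝ) : Prop :=
  IsEpsBalanced ε (scaling K x)

theorem scaling_apply (K : Matrix (Fin n) (Fin n) ℝ) (x : Fin n → ℝ) (i j : Fin n) :
    scaling K x i j = Real.exp (x i - x j) * K i j := by
  simp only [scaling, Matrix.mul_diagonal, Matrix.diagonal_mul, sub_eq_add_neg, Real.exp_add]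
  ring

/-! ### The parameters `m`, `κ`, `d` -/

/-- The number `m` of nonzero entries of `K`. -/
def nnz (K : Matrix (Fin n) (Fin n) ℝ) : ℕ := {p : Fin n × Fin n | K p.1 p.2 ≠ 0}.ncard

/-- The smallest nonzero entry `K_min` (of a nonnegative nonzero matrix). -/
def minEntry (K : Matrix (Fin n) (Fin n) ℝ) : ℝ := sInf {a | ∃ i j, 0 < K i j ∧ K i j = a}

/-- The condition number `κ = (∑ i j, K i j) / K_min`. -/
def condNumber (K : Matrix (Fin n) (Fin n) ℝ) : ℝ := (∑ i, ∑ j, K i j) / minEntry K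

/-- In the directed graph `G_K` with an edge from `i` to `j` whenever `K i j > 0`, there is
a directed walk with `l` edges from `u` to `v`. -/
def HasWalk (K : Matrix (Fin n) (Fin n) ℝ) (u v : Fin n) (l : ℕ) : Prop :=
  ∃ p : ℕ → Fin n, p 0 = u ∧ p l = v ∧ ∀ s < l, 0 < K (p s) (p (s + 1))

/-- The directed distance from `u` to `v` in `G_K`; it is `⊤` if `v` is not reachable. -/
def graphDist (K : Matrix (Fin n) (Fin n) ℝ) (u v : Fin n) : ℕ∞ :=
  ⨅ (l : ℕ) (_ : HasWalk K u v l), (l : ℕ∞)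

/-- The diameter `d` of `G_K`; it is `⊤` if `G_K` is not strongly connected. -/
def graphDiam (K : Matrix (Fin n) (Fin n) ℝ) : ℕ∞ := ⨆ (u : Fin n) (v : Fin n), graphDist K u v

/-- The quantity `(m / ε) (1 / ε ∧ d) log κ`. It is finite for `ε > 0`, also if `d = ⊤`. -/
def rate (K : Matrix (Fin n) (Fin n) ℝ) (ε : ℝ) : ℝ≥0∞ :=
  (nnz K : ℝ≥0∞) / ENNReal.ofReal ε
    * min (1 / ENNReal.ofReal ε) (graphDiam K : ℝ≥0∞)
    * ENNReal.ofReal (Real.log (condNumber K))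

end Balancing

/-! ### Exact real computations with a count of the arithmetic operations -/

/-- The result of a computation, with the number of arithmetic operations that it used. -/
structure Counted (α : Type) where
  val : α
  ops : ℕ

namespace Counted

instance : Monad Counted where
  pure a := ⟨a, 0⟩
  bind c f := ⟨(f c.val).val, c.ops + (f c.val).ops⟩

/-- The elementary arithmetic operations on real numbers; each of them counts once. -/
def add (a b : ℝ) : Counted ℝ := ⟨a + b, 1⟩
def sub (a b : ℝ) : Counted ℝ := ⟨a - b, 1⟩
def mul (a b : ℝ) : Counted ℝ := ⟨a * b, 1⟩
def div (a b : ℝ) : Counted ℝ := ⟨a / b, 1⟩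
def exp (a : ℝ) : Counted ℝ := ⟨Real.exp a, 1⟩
def log (a : ℝ) : Counted ℝ := ⟨Real.log a, 1⟩

end Counted

/-! ### Osborne's algorithm -/

section Algorithm

variable {n : ℕ}

open Classical in
/-- The list of the nonzero positions in row `k`. -/
def rowList (K : Matrix (Fin n) (Fin n) ℝ) (k : Fin n) : List (Fin n) :=
  (List.finRange n).filter fun j => K k j ≠ 0

open Classical in
/-- The list of the nonzero positions in column `k`. -/
def colList (K : Matrix (Fin n) (Fin n) ℝ) (k : Fin n) : List (Fin n) :=
  (List.finRange n).filter fun i => K i k ≠ 0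

/-- Computes the `k`-th row sum of the current scaling from the nonzeros in row `k` of `K`. -/
def computeRow (K : Matrix (Fin n) (Fin n) ℝ) (x : Fin n → ℝ) (k : Fin n) : Counted ℝ :=
  (rowList K k).foldlM (init := (0 : ℝ)) fun s j => do
    let u ← Counted.sub (x k) (x j)
    let e ← Counted.exp u
    let a ← Counted.mul e (K k j)
    Counted.add s a

/-- Computes the `k`-th column sum of the current scaling from the nonzeros in column `k`
of `K`. -/
def computeCol (K : Matrix (Fin n) (Fin n) ℝ) (x : Fin n → ℝ) (k : Fin n) : Counted ℝ :=
  (colList K k).foldlM (init := (0 : ℝ)) fun s i => do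
    let u ← Counted.sub (x i) (x k)
    let e ← Counted.exp u
    let a ← Counted.mul e (K i k)
    Counted.add s a

open Classical in
/-- The Osborne update on coordinate `k`, that is `x_k ← x_k + (log c_k - log r_k) / 2` with the
row and column sums of the current scaling. A coordinate whose row or column in `K` vanishes is
left alone, since the logarithm of the sum is then undefined. (If `K` is balanceable, such a row
and column vanish together, so there is nothing to balance.) -/
def update (K : Matrix (Fin n) (Fin n) ℝ) (x : Fin n → ℝ) (k : Fin n) : Counted (Fin n → ℝ) :=
  if rowList K k = [] ∨ colList K k = [] then pure x else do
    let r ← computeRow K x k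
    let c ← computeCol K x k
    let lc ← Counted.log c
    let lr ← Counted.log r
    let w ← Counted.sub lc lr
    let h ← Counted.div w 2
    let y ← Counted.add (x k) h
    pure (Function.update x k y)

/-- The iterate after `t` updates, started at the zero vector; the `t`-th update (counted from
`0`) is on coordinate `k t`. -/
def iterate (K : Matrix (Fin n) (Fin n) ℝ) (k : ℕ → Fin n) : ℕ → Fin n → ℝ
  | 0 => 0
  | t + 1 => (update K (iterate K k t) (k t)).val

/-- The number of arithmetic operations of the `t`-th update. -/
def stepOps (K : Matrix (Fin n) (Fin n) ℝ) (k : ℕ → Fin n) (t : ℕ) : ℕ :=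
  (update K (iterate K k t) (k t)).ops

open Classical in
/-- The output: the first iterate whose scaling is `ε`-balanced; `none` if the loop never ends. -/
def output (K : Matrix (Fin n) (Fin n) ℝ) (ε : ℝ) (k : ℕ → Fin n) : Option (Fin n → ℝ) :=
  if h : ∃ t, IsEpsBalanced ε (scaling K (iterate K k t)) then some (iterate K k (Nat.find h))
  else none

open Classical in
/-- The total number of arithmetic operations of the updates performed until the loop ends;
`∞` if it never ends. -/
def totalOps (K : Matrix (Fin n) (Fin n) ℝ) (ε : ℝ) (k : ℕ → Fin n) : ℝ≥0∞ :=
  if h : ∃ t, IsEpsBalanced ε (scaling K (iterate K k t)) then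
    ((∑ t ∈ Finset.range (Nat.find h), stepOps K k t : ℕ) : ℝ≥0∞)
  else ∞

/-! The program computes the update of Osborne's algorithm, with a number of operations that is
proportional to the number of nonzeros in the row and column. -/

theorem val_bind {α β : Type} (c : Counted α) (f : α → Counted β) :
    (c >>= f).val = (f c.val).val := rfl

theorem ops_bind {α β : Type} (c : Counted α) (f : α → Counted β) :
    (c >>= f).ops = c.ops + (f c.val).ops := rfl

theorem val_pure {α : Type} (a : α) : (pure a : Counted α).val = a := rfl

theorem ops_pure {α : Type} (a : α) : (pure a : Counted α).ops = 0 := rfl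

theorem fold_eq {ι : Type} (l : List ι) (g : ι → ℝ) (f : ℝ → ι → Counted ℝ)
    (hv : ∀ s j, (f s j).val = s + g j) (ho : ∀ s j, (f s j).ops = 4) (s : ℝ) :
    (l.foldlM f s).val = s + (l.map g).sum ∧ (l.foldlM f s).ops = 4 * l.length := by
  induction l generalizing s with
  | nil => simp [val_pure, ops_pure]
  | cons a l ih =>
    rw [List.foldlM_cons, val_bind, ops_bind, (ih _).1, (ih _).2, hv, ho]
    constructor
    · simp [add_assoc]
    · simp; ring

theorem sum_list_filter (g : Fin n → ℝ) (p : Fin n → Prop) [DecidablePred p]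
    (h : ∀ j, ¬ p j → g j = 0) :
    (((List.finRange n).filter fun j => p j).map g).sum = ∑ j, g j := by
  rw [← List.sum_ofFn, List.ofFn_eq_map]
  induction List.finRange n with
  | nil => rfl
  | cons a l ih =>
    by_cases ha : p a
    · simp [ha, ih]
    · simp [ha, ih, h a ha]

theorem computeRow_eq (K : Matrix (Fin n) (Fin n) ℝ) (x : Fin n → ℝ) (k : Fin n) :
    (computeRow K x k).val = rowSum (scaling K x) k
      ∧ (computeRow K x k).ops = 4 * (rowList K k).length := by
  classical
  have h := fold_eq (rowList K k) (fun j => Real.exp (x k - x j) * K k j) (fun s j => do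
    let u ← Counted.sub (x k) (x j)
    let e ← Counted.exp u
    let a ← Counted.mul e (K k j)
    Counted.add s a) (fun _ _ => rfl) (fun _ _ => rfl) 0
  refine ⟨h.1.trans ?_, h.2⟩
  rw [zero_add, rowList]
  simp only [rowSum, scaling_apply]
  convert sum_list_filter (fun j => Real.exp (x k - x j) * K k j) (fun j => K k j ≠ 0) ?_
  intro j hj
  simp [not_not.mp hj]

theorem computeCol_eq (K : Matrix (Fin n) (Fin n) ℝ) (x : Fin n → ℝ) (k : Fin n) :
    (computeCol K x k).val = colSum (scaling K x) k
      ∧ (computeCol K x k).ops = 4 * (colList K k).length := by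
  classical
  have h := fold_eq (colList K k) (fun i => Real.exp (x i - x k) * K i k) (fun s i => do
    let u ← Counted.sub (x i) (x k)
    let e ← Counted.exp u
    let a ← Counted.mul e (K i k)
    Counted.add s a) (fun _ _ => rfl) (fun _ _ => rfl) 0
  refine ⟨h.1.trans ?_, h.2⟩
  rw [zero_add, colList]
  simp only [colSum, scaling_apply]
  convert sum_list_filter (fun i => Real.exp (x i - x k) * K i k) (fun i => K i k ≠ 0) ?_
  intro j hj
  simp [not_not.mp hj]

theorem update_val (K : Matrix (Fin n) (Fin n) ℝ) (x : Fin n → ℝ) (k : Fin n)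
    (hr : rowList K k ≠ []) (hc : colList K k ≠ []) :
    (update K x k).val = Function.update x k
      (x k + (Real.log (colSum (scaling K x) k) - Real.log (rowSum (scaling K x) k)) / 2) := by
  rw [← (computeRow_eq K x k).1, ← (computeCol_eq K x k).1, update, if_neg (by tauto)]
  rfl

theorem update_ops (K : Matrix (Fin n) (Fin n) ℝ) (x : Fin n → ℝ) (k : Fin n)
    (hr : rowList K k ≠ []) (hc : colList K k ≠ []) :
    (update K x k).ops = 4 * (rowList K k).length + (4 * (colList K k).length + 5) := by
  rw [← (computeRow_eq K x k).2, ← (computeCol_eq K x k).2, update, if_neg (by tauto)]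
  rfl

end Algorithm

end Osborne

end

/-!
Write `S(x)` for the sum of the entries of `diag(e^x) K diag(e^{-x})` (`mass`), `z` for a balanced
scaling, `δ(x) = log S(x) - log S(z)` for the suboptimality and `g(x) = ‖r - c‖₁ / S(x)` for the
imbalance. `log S` is convex with gradient `(r - c) / S`, so `z` is a minimizer, and the suboptimality
of `x` is at most `g(x)` times the oscillation of `x - z` (`log_mass_sub_le`). Along an edge,
the coordinates of a point of mass at most `S(0)` drop by at most `log κ`, so this oscillation is at most
`2 d log κ`. Hence `ρ δ ≤ g` with `ρ = 1 / (2 d log κ)`, or with `ρ = 0` if `d = ∞`. Also,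
`δ(0) ≤ log κ` (`log_mass_zero_sub_le`).

An update on coordinate `k` decreases `S` by at least `(√r_k - √c_k)²`, so by Cauchy-Schwarz the
decreases of `log S` over all `k` add up to at least `g² / 4` (`sq_imbalance_le_sum_log_sub`). Since
`g ≥ max(ε, ρ δ)` as long as `x` is not `ε`-balanced, the concave function
`δ / (ε (ε + ρ δ))` of `δ`, with derivative `1 / (ε + ρ δ)²`, decreases on average by at least
`1 / (16 n)` per update (`sum_gapPotential_sub`). It takes values in `[0, Q]` for
`Q = 2 (1 / ε) (1 / ε ∧ d) log κ`.

An update costs `O(m / n)` operations on average and `O(m)` at most. If `W ∈ [0, 1]` is the potential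
divided by `Q`, and `μ` is a small multiple of `1 / (m Q)`, then `e^{μ cost} (1 + W)` is therefore a
supermartingale up to the stopping time (`lintegral_exp_stoppedCost_le`), since
`e^{μ cost} ≤ 1 + 2 μ cost` if `μ cost ≤ 1`. So
`𝔼 e^{μ T} ≤ 2`, which gives both the expectation bound, by `y ≤ e^y`, and the tail bound, by Markov's
inequality. Almost sure termination follows too, by charging a further `m / n` for each update: a run
that does not end has infinite cost.
-/

/-! ### Mass and imbalance of a scaling -/

namespace Osborne

section Balancing

variable {n : ℕ}

/-- The sum of all entries of `diag(e^x) K diag(e^{-x})`, the objective that Osborne's algorithm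
decreases. -/
noncomputable def mass (K : Matrix (Fin n) (Fin n) ℝ) (x : Fin n → ℝ) : ℝ :=
  ∑ i, ∑ j, scaling K x i j

/-- The relative imbalance `‖r(A) - c(A)‖₁ / ∑ i j, A i j` of `A = diag(e^x) K diag(e^{-x})`. -/
noncomputable def imbalance (K : Matrix (Fin n) (Fin n) ℝ) (x : Fin n → ℝ) : ℝ :=
  (∑ i, |rowSum (scaling K x) i - colSum (scaling K x) i|) / mass K x

variable {K : Matrix (Fin n) (Fin n) ℝ}

theorem scaling_nonneg (hK : ∀ i j, 0 ≤ K i j) (x : Fin n → ℝ) (i j : Fin n) :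
    0 ≤ scaling K x i j := by
  rw [scaling_apply]
  exact mul_nonneg (Real.exp_pos _).le (hK i j)

theorem rowSum_scaling_nonneg (hK : ∀ i j, 0 ≤ K i j) (x : Fin n → ℝ) (i : Fin n) :
    0 ≤ rowSum (scaling K x) i :=
  Finset.sum_nonneg fun j _ => scaling_nonneg hK x i j

theorem colSum_scaling_nonneg (hK : ∀ i j, 0 ≤ K i j) (x : Fin n → ℝ) (j : Fin n) :
    0 ≤ colSum (scaling K x) j :=
  Finset.sum_nonneg fun i _ => scaling_nonneg hK x i j

theorem sum_rowSum_scaling (x : Fin n → ℝ) : ∑ i, rowSum (scaling K x) i = mass K x := rfl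

theorem sum_colSum_scaling (x : Fin n → ℝ) : ∑ i, colSum (scaling K x) i = mass K x :=
  Finset.sum_comm

theorem scaling_zero : scaling K 0 = K := by
  ext i j
  simp [scaling_apply]

theorem scaling_le_mass (hK : ∀ i j, 0 ≤ K i j) (x : Fin n → ℝ) (i j : Fin n) :
    scaling K x i j ≤ mass K x :=
  (Finset.single_le_sum (fun j _ => scaling_nonneg hK x i j) (Finset.mem_univ j)).trans
    (Finset.single_le_sum (fun i _ => rowSum_scaling_nonneg hK x i) (Finset.mem_univ i))

theorem exists_entry_pos (hK : ∀ i j, 0 ≤ K i j) (h0 : K ≠ 0) : ∃ i j, 0 < K i j := by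
  by_contra! h
  exact h0 (by ext i j; exact le_antisymm (h i j) (hK i j))

theorem mass_pos (hK : ∀ i j, 0 ≤ K i j) (h0 : K ≠ 0) (x : Fin n → ℝ) : 0 < mass K x := by
  obtain ⟨i, j, h⟩ := exists_entry_pos hK h0
  refine lt_of_lt_of_le ?_ (scaling_le_mass hK x i j)
  rw [scaling_apply]
  positivity

theorem rowSum_scaling_pos_iff (hK : ∀ i j, 0 ≤ K i j) (x : Fin n → ℝ) (i : Fin n) :
    0 < rowSum (scaling K x) i ↔ ∃ j, 0 < K i j := by
  unfold rowSum
  rw [Finset.sum_pos_iff_of_nonneg fun j _ => scaling_nonneg hK x i j]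
  simp [scaling_apply, Real.exp_pos]

theorem colSum_scaling_pos_iff (hK : ∀ i j, 0 ≤ K i j) (x : Fin n → ℝ) (j : Fin n) :
    0 < colSum (scaling K x) j ↔ ∃ i, 0 < K i j := by
  unfold colSum
  rw [Finset.sum_pos_iff_of_nonneg fun i _ => scaling_nonneg hK x i j]
  simp [scaling_apply, Real.exp_pos]

/-- In a balanceable matrix, a row vanishes if and only if the corresponding column does. -/
theorem row_pos_iff_col_pos (hK : ∀ i j, 0 ≤ K i j) (hb : Balanceable K) (k : Fin n) :
    (∃ j, 0 < K k j) ↔ ∃ i, 0 < K i k := by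
  obtain ⟨z, hz⟩ := hb
  rw [← rowSum_scaling_pos_iff hK z, ← colSum_scaling_pos_iff hK z, congrFun hz k]

theorem rowList_ne_nil_iff (hK : ∀ i j, 0 ≤ K i j) (k : Fin n) :
    rowList K k ≠ [] ↔ ∃ j, 0 < K k j := by
  simp [rowList, List.filter_eq_nil_iff, (hK _ _).lt_iff_ne']

theorem colList_ne_nil_iff (hK : ∀ i j, 0 ≤ K i j) (k : Fin n) :
    colList K k ≠ [] ↔ ∃ i, 0 < K i k := by
  simp [colList, List.filter_eq_nil_iff, (hK _ _).lt_iff_ne']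

/-- If one coordinate moves by `h`, row `k` is multiplied by `s = e^h` and column `k` by `s⁻¹`. The
diagonal entry, which does not change, is bounded by means of `s + s⁻¹ ≥ 2`. -/
theorem mass_update_le (hK : ∀ i j, 0 ≤ K i j) (x : Fin n → ℝ) (k : Fin n) (h : ℝ) :
    mass K (Function.update x k (x k + h)) ≤ mass K x
      + ((Real.exp h - 1) * rowSum (scaling K x) k
        + (Real.exp (-h) - 1) * colSum (scaling K x) k) := by
  have key : ∀ i j, scaling K (Function.update x k (x k + h)) i j ≤ scaling K x i j
      + ((if i = k then (Real.exp h - 1) * scaling K x i j else 0)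
        + if j = k then (Real.exp (-h) - 1) * scaling K x i j else 0) := by
    intro i j
    have hs : 2 ≤ Real.exp h + Real.exp (-h) := by
      have h1 : Real.exp h * Real.exp (-h) = 1 := by rw [← Real.exp_add]; simp
      nlinarith [sq_nonneg (Real.exp h - Real.exp (-h)), Real.exp_pos h, Real.exp_pos (-h)]
    have hA := scaling_nonneg hK x i j
    rw [scaling_apply] at hA ⊢
    rw [scaling_apply]
    by_cases hi : i = k <;> by_cases hj : j = k
    · subst hi; subst hj
      simp only [sub_self, if_true]
      simp only [sub_self] at hA
      nlinarith
    · subst hi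
      simp only [Function.update_self, Function.update_of_ne hj, if_true, if_neg hj]
      rw [show x i + h - x j = h + (x i - x j) by ring, Real.exp_add]
      exact le_of_eq (by ring)
    · subst hj
      simp only [Function.update_self, Function.update_of_ne hi, if_true, if_neg hi]
      rw [show x i - (x j + h) = -h + (x i - x j) by ring, Real.exp_add]
      exact le_of_eq (by ring)
    · simp [hi, hj]
  calc mass K (Function.update x k (x k + h))
      ≤ ∑ i, ∑ j, (scaling K x i j
      + ((if i = k then (Real.exp h - 1) * scaling K x i j else 0)
        + if j = k then (Real.exp (-h) - 1) * scaling K x i j else 0)) :=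
        Finset.sum_le_sum fun i _ => Finset.sum_le_sum fun j _ => key i j
    _ = _ := by
        have h1 : ∀ i, ∑ j, (if i = k then (Real.exp h - 1) * scaling K x i j else 0)
            = if i = k then (Real.exp h - 1) * rowSum (scaling K x) k else 0 := by
          intro i
          by_cases hi : i = k
          · subst hi; simp [rowSum, Finset.mul_sum]
          · simp [hi]
        simp only [Finset.sum_add_distrib, h1, Finset.sum_ite_eq', Finset.mem_univ, if_true,
          mass, colSum, Finset.mul_sum]

/-- An Osborne update on coordinate `k` decreases the mass by at least `(√r_k - √c_k)²`. -/
theorem mass_osborne_update_le (hK : ∀ i j, 0 ≤ K i j) (hb : Balanceable K) (x : Fin n → ℝ)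
    (k : Fin n) :
    mass K (update K x k).val ≤ mass K x
      - (√(rowSum (scaling K x) k) - √(colSum (scaling K x) k)) ^ 2 := by
  by_cases hr : ∃ j, 0 < K k j
  · have hc := (row_pos_iff_col_pos hK hb k).1 hr
    rw [update_val K x k ((rowList_ne_nil_iff hK k).2 hr) ((colList_ne_nil_iff hK k).2 hc)]
    refine (mass_update_le hK x k _).trans ?_
    have hr' := (rowSum_scaling_pos_iff hK x k).2 hr
    have hc' := (colSum_scaling_pos_iff hK x k).2 hc
    set r := rowSum (scaling K x) k
    set c := colSum (scaling K x) k
    have e1 : Real.exp ((Real.log c - Real.log r) / 2) = √c / √r := by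
      rw [sub_div, Real.exp_sub, Real.exp_half, Real.exp_half, Real.exp_log hc', Real.exp_log hr']
    have e2 : Real.exp (-((Real.log c - Real.log r) / 2)) = √r / √c := by
      rw [Real.exp_neg, e1, inv_div]
    rw [e1, e2]
    have ha := Real.sqrt_pos.2 hr'
    have hb := Real.sqrt_pos.2 hc'
    have ha2 := Real.sq_sqrt hr'.le
    have hb2 := Real.sq_sqrt hc'.le
    apply le_of_eq
    set a := √r
    set b := √c
    rw [← ha2, ← hb2]
    field_simp
    ring
  · have hc : ¬ ∃ i, 0 < K i k := fun h => hr ((row_pos_iff_col_pos hK hb k).2 h)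
    have h1 : (update K x k).val = x := by
      rw [update, if_pos (Or.inl (not_not.1 fun h => hr ((rowList_ne_nil_iff hK k).1 h)))]
      rfl
    have h2 : rowSum (scaling K x) k = 0 := le_antisymm
      (not_lt.1 fun h => hr ((rowSum_scaling_pos_iff hK x k).1 h)) (rowSum_scaling_nonneg hK x k)
    have h3 : colSum (scaling K x) k = 0 := le_antisymm
      (not_lt.1 fun h => hc ((colSum_scaling_pos_iff hK x k).1 h)) (colSum_scaling_nonneg hK x k)
    simp [h1, h2, h3]

/-- The squared Hellinger distance of `r` and `c` dominates their squared `ℓ¹`-distance. -/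
theorem sq_sum_abs_sub_le {ι : Type*} [Fintype ι] (r c : ι → ℝ) (hr : ∀ i, 0 ≤ r i)
    (hc : ∀ i, 0 ≤ c i) :
    (∑ i, |r i - c i|) ^ 2 ≤ (∑ i, (√(r i) - √(c i)) ^ 2) * (2 * (∑ i, r i + ∑ i, c i)) := by
  have h1 : ∀ i, |r i - c i| = |√(r i) - √(c i)| * (√(r i) + √(c i)) := by
    intro i
    rw [← abs_of_nonneg (add_nonneg (Real.sqrt_nonneg (r i)) (Real.sqrt_nonneg (c i))), ← abs_mul]
    congr 1
    nlinarith [Real.sq_sqrt (hr i), Real.sq_sqrt (hc i)]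
  simp only [h1]
  refine (Finset.sum_mul_sq_le_sq_mul_sq _ _ _).trans ?_
  simp only [sq_abs]
  refine mul_le_mul_of_nonneg_left ?_ (Finset.sum_nonneg fun i _ => sq_nonneg _)
  rw [← Finset.sum_add_distrib, Finset.mul_sum]
  refine Finset.sum_le_sum fun i _ => ?_
  nlinarith [Real.sq_sqrt (hr i), Real.sq_sqrt (hc i), sq_nonneg (√(r i) - √(c i))]

/-- Summed over all coordinates, the decrease of the logarithm of the mass by an update is at
least a quarter of the squared imbalance. -/
theorem sq_imbalance_le_sum_log_sub (hK : ∀ i j, 0 ≤ K i j) (h0 : K ≠ 0) (hb : Balanceable K)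
    (x : Fin n → ℝ) :
    imbalance K x ^ 2 / 4
      ≤ ∑ k, (Real.log (mass K x) - Real.log (mass K (update K x k).val)) := by
  have hS := mass_pos hK h0 x
  have h1 : ∀ k, (√(rowSum (scaling K x) k) - √(colSum (scaling K x) k)) ^ 2 / mass K x
      ≤ Real.log (mass K x) - Real.log (mass K (update K x k).val) := by
    intro k
    have hS' := mass_pos hK h0 (update K x k).val
    have h2 := Real.log_le_sub_one_of_pos (div_pos hS' hS)
    rw [Real.log_div hS'.ne' hS.ne'] at h2
    have h3 : (√(rowSum (scaling K x) k) - √(colSum (scaling K x) k)) ^ 2 / mass K x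
        ≤ 1 - mass K (update K x k).val / mass K x := by
      rw [div_le_iff₀ hS, sub_mul, div_mul_cancel₀ _ hS.ne']
      linarith [mass_osborne_update_le hK hb x k]
    linarith
  refine le_trans ?_ (Finset.sum_le_sum fun k _ => h1 k)
  have h4 := sq_sum_abs_sub_le (rowSum (scaling K x)) (colSum (scaling K x))
    (rowSum_scaling_nonneg hK x) (colSum_scaling_nonneg hK x)
  rw [sum_rowSum_scaling, sum_colSum_scaling] at h4
  rw [← Finset.sum_div, imbalance, div_pow, div_div, div_le_div_iff₀ (by positivity) hS]
  nlinarith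

theorem mass_update_le_mass (hK : ∀ i j, 0 ≤ K i j) (hb : Balanceable K) (x : Fin n → ℝ)
    (k : Fin n) : mass K (update K x k).val ≤ mass K x :=
  (mass_osborne_update_le hK hb x k).trans (sub_le_self _ (sq_nonneg _))

/-- Convexity of the logarithm of the mass: its graph lies above the tangent at `x`, whose slope
is `(r - c) / mass`. -/
theorem log_mass_tangent (hK : ∀ i j, 0 ≤ K i j) (h0 : K ≠ 0) (x y : Fin n → ℝ) :
    Real.log (mass K x)
      + (∑ i, (rowSum (scaling K x) i - colSum (scaling K x) i) * (y i - x i)) / mass K x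
      ≤ Real.log (mass K y) := by
  have hS := mass_pos hK h0 x
  set S := mass K x with hSdef
  set D := ∑ i, (rowSum (scaling K x) i - colSum (scaling K x) i) * (y i - x i) with hD
  have hD' : ∑ i, ∑ j, scaling K x i j * ((y i - x i) - (y j - x j)) = D := by
    simp only [mul_sub, Finset.sum_sub_distrib, sub_mul, hD, rowSum, colSum, Finset.sum_mul]
    rw [Finset.sum_comm (f := fun i j => scaling K x i j * y j),
      Finset.sum_comm (f := fun i j => scaling K x i j * x j)]
    ring
  rw [Real.le_log_iff_exp_le (mass_pos hK h0 y), Real.exp_add, Real.exp_log hS]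
  have key : ∀ i j, Real.exp (D / S) * (scaling K x i j * (1 - D / S)
      + scaling K x i j * ((y i - x i) - (y j - x j))) ≤ scaling K y i j := by
    intro i j
    have e : scaling K y i j
        = scaling K x i j * (Real.exp (D / S) * Real.exp ((y i - x i) - (y j - x j) - D / S)) := by
      rw [scaling_apply, scaling_apply, ← Real.exp_add, mul_right_comm, ← Real.exp_add]
      congr 2
      ring
    rw [e]
    have := Real.add_one_le_exp ((y i - x i) - (y j - x j) - D / S)
    calc _ = scaling K x i j * (Real.exp (D / S) * ((y i - x i) - (y j - x j) - D / S + 1)) := by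
          ring
      _ ≤ _ := by
          have := scaling_nonneg hK x i j
          gcongr
  calc S * Real.exp (D / S) = ∑ i, ∑ j, Real.exp (D / S) * (scaling K x i j * (1 - D / S)
      + scaling K x i j * ((y i - x i) - (y j - x j))) := by
        simp only [← Finset.mul_sum, Finset.sum_add_distrib, ← Finset.sum_mul]
        rw [hD', ← mass, ← hSdef]
        field_simp
        ring
    _ ≤ mass K y := Finset.sum_le_sum fun i _ => Finset.sum_le_sum fun j _ => key i j

/-- A balanced scaling minimizes the mass. -/
theorem mass_le_of_isBalanced (hK : ∀ i j, 0 ≤ K i j) (h0 : K ≠ 0) {z : Fin n → ℝ}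
    (hz : IsBalanced (scaling K z)) (x : Fin n → ℝ) : mass K z ≤ mass K x := by
  have h := log_mass_tangent hK h0 z x
  have hz' : rowSum (scaling K z) = colSum (scaling K z) := hz
  simp only [hz', sub_self, zero_mul, Finset.sum_const_zero, zero_div, add_zero] at h
  exact (Real.log_le_log_iff (mass_pos hK h0 z) (mass_pos hK h0 x)).1 h

/-- If the oscillation of `x - z` is at most `R`, the suboptimality of `x` with respect to `z`
is at most `R` times the imbalance. -/
theorem log_mass_sub_le (hK : ∀ i j, 0 ≤ K i j) (h0 : K ≠ 0) {x z : Fin n → ℝ} {R : ℝ}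
    (hR : ∀ i j, (x i - z i) - (x j - z j) ≤ R) :
    Real.log (mass K x) - Real.log (mass K z) ≤ R * imbalance K x := by
  have hS := mass_pos hK h0 x
  obtain ⟨i₀, -, -⟩ := exists_entry_pos hK h0
  have h := log_mass_tangent hK h0 x z
  -- the sum of `r - c` vanishes, so `z - x` may be shifted by a constant
  have e : ∑ i, (rowSum (scaling K x) i - colSum (scaling K x) i) * (z i - x i)
      = ∑ i, (rowSum (scaling K x) i - colSum (scaling K x) i)
          * ((z i - x i) - (z i₀ - x i₀)) := by
    simp only [mul_sub _ (z _ - x _) (z i₀ - x i₀), Finset.sum_sub_distrib, ← Finset.sum_mul,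
      sum_rowSum_scaling, sum_colSum_scaling, sub_self, zero_mul, sub_zero]
  have h2 : -(R * ∑ i, |rowSum (scaling K x) i - colSum (scaling K x) i|)
      ≤ ∑ i, (rowSum (scaling K x) i - colSum (scaling K x) i)
          * ((z i - x i) - (z i₀ - x i₀)) := by
    rw [Finset.mul_sum, ← Finset.sum_neg_distrib]
    refine Finset.sum_le_sum fun i _ => ?_
    refine le_trans ?_ (neg_abs_le _)
    rw [abs_mul, mul_comm R]
    refine neg_le_neg (mul_le_mul_of_nonneg_left ?_ (abs_nonneg _))
    rw [abs_le]
    constructor <;> linarith [hR i i₀, hR i₀ i]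
  rw [← e] at h2
  have h3 : -(R * imbalance K x)
      ≤ (∑ i, (rowSum (scaling K x) i - colSum (scaling K x) i) * (z i - x i)) / mass K x := by
    rw [imbalance, mul_div, ← neg_div]
    gcongr
  linarith

end Balancing

end Osborne

/-! ### The parameters of the graph, and the potential -/

namespace Osborne

section Parameters

variable {n : ℕ} {K : Matrix (Fin n) (Fin n) ℝ}

theorem minEntry_le {i j : Fin n} (h : 0 < K i j) : minEntry K ≤ K i j :=
  csInf_le ⟨0, by rintro a ⟨i, j, h, rfl⟩; exact h.le⟩ ⟨i, j, h, rfl⟩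

theorem minEntry_pos (hK : ∀ i j, 0 ≤ K i j) (h0 : K ≠ 0) : 0 < minEntry K := by
  have hfin : {a | ∃ i j, 0 < K i j ∧ K i j = a}.Finite := by
    refine (Set.finite_range fun p : Fin n × Fin n => K p.1 p.2).subset ?_
    rintro a ⟨i, j, -, rfl⟩
    exact ⟨(i, j), rfl⟩
  obtain ⟨i, j, h⟩ := exists_entry_pos hK h0
  have hne : {a | ∃ i j, 0 < K i j ∧ K i j = a}.Nonempty := ⟨_, i, j, h, rfl⟩
  obtain ⟨i, j, h, e⟩ := hne.csInf_mem hfin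
  rw [minEntry, ← e]
  exact h

theorem condNumber_eq (K : Matrix (Fin n) (Fin n) ℝ) :
    condNumber K = mass K 0 / minEntry K := by
  rw [condNumber, mass, scaling_zero]

/-- The mass of a balanced scaling is at least `K_min`: if `z j` is minimal among the coordinates
`j` with a nonzero column, then an edge into `j` has an entry that is not decreased by the
scaling. -/
theorem minEntry_le_mass_of_isBalanced (hK : ∀ i j, 0 ≤ K i j) (h0 : K ≠ 0) {z : Fin n → ℝ}
    (hz : IsBalanced (scaling K z)) : minEntry K ≤ mass K z := by
  classical
  obtain ⟨i₀, j₀, h⟩ := exists_entry_pos hK h0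
  obtain ⟨j, hj, hmin⟩ := Finset.exists_min_image
    (Finset.univ.filter fun j => ∃ i, 0 < K i j) z ⟨j₀, by simpa using ⟨i₀, h⟩⟩
  obtain ⟨i, hi⟩ := (Finset.mem_filter.1 hj).2
  have hij : z j ≤ z i := hmin i (Finset.mem_filter.2
    ⟨Finset.mem_univ _, (row_pos_iff_col_pos hK ⟨z, hz⟩ i).1 ⟨j, hi⟩⟩)
  calc minEntry K ≤ K i j := minEntry_le hi
    _ ≤ scaling K z i j := by
        rw [scaling_apply]
        exact le_mul_of_one_le_left hi.le (Real.one_le_exp (sub_nonneg.2 hij))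
    _ ≤ mass K z := scaling_le_mass hK z i j

theorem log_mass_zero_sub_le (hK : ∀ i j, 0 ≤ K i j) (h0 : K ≠ 0) {z : Fin n → ℝ}
    (hz : IsBalanced (scaling K z)) :
    Real.log (mass K 0) - Real.log (mass K z) ≤ Real.log (condNumber K) := by
  have hmin := minEntry_pos hK h0
  rw [condNumber_eq, Real.log_div (mass_pos hK h0 0).ne' hmin.ne']
  have := Real.log_le_log hmin (minEntry_le_mass_of_isBalanced hK h0 hz)
  linarith

theorem sub_le_log_condNumber (hK : ∀ i j, 0 ≤ K i j) (h0 : K ≠ 0) {x : Fin n → ℝ}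
    (hx : mass K x ≤ mass K 0) {i j : Fin n} (hij : 0 < K i j) :
    x i - x j ≤ Real.log (condNumber K) := by
  have hmin := minEntry_pos hK h0
  rw [condNumber_eq, Real.le_log_iff_exp_le (div_pos (mass_pos hK h0 0) hmin), le_div_iff₀ hmin]
  calc Real.exp (x i - x j) * minEntry K ≤ Real.exp (x i - x j) * K i j := by
        gcongr
        exact minEntry_le hij
    _ = scaling K x i j := (scaling_apply K x i j).symm
    _ ≤ mass K x := scaling_le_mass hK x i j
    _ ≤ mass K 0 := hx

theorem sub_le_of_hasWalk (hK : ∀ i j, 0 ≤ K i j) (h0 : K ≠ 0) {x : Fin n → ℝ}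
    (hx : mass K x ≤ mass K 0) {u v : Fin n} {l : ℕ} (h : HasWalk K u v l) :
    x u - x v ≤ l * Real.log (condNumber K) := by
  obtain ⟨p, rfl, rfl, hp⟩ := h
  calc x (p 0) - x (p l) = ∑ s ∈ Finset.range l, (x (p s) - x (p (s + 1))) :=
        (Finset.sum_range_sub' (fun s => x (p s)) l).symm
    _ ≤ ∑ _s ∈ Finset.range l, Real.log (condNumber K) := Finset.sum_le_sum fun s hs =>
        sub_le_log_condNumber hK h0 hx (hp s (Finset.mem_range.1 hs))
    _ = l * Real.log (condNumber K) := by simp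

theorem exists_hasWalk_of_graphDiam_eq {D : ℕ} (h : graphDiam K = D) (u v : Fin n) :
    ∃ l ≤ D, HasWalk K u v l := by
  by_contra! hl
  have h1 : ((D + 1 : ℕ) : ℕ∞) ≤ graphDist K u v := by
    refine le_iInf₂ fun l hw => ?_
    have : D < l := not_le.1 fun h => hl l h hw
    exact_mod_cast this
  have h2 : graphDist K u v ≤ graphDiam K := le_iSup₂ (f := fun u v => graphDist K u v) u v
  rw [h] at h2
  have := h1.trans h2
  norm_cast at this
  omega

/-- A nonnegative matrix that is not balanced has an off-diagonal nonzero entry. -/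
theorem exists_offDiag_pos (hK : ∀ i j, 0 ≤ K i j) (h : 0 < imbalance K 0) :
    ∃ i j, i ≠ j ∧ 0 < K i j := by
  by_contra! hd
  have hd' : ∀ i j, i ≠ j → K i j = 0 := fun i j hij => le_antisymm (hd i j hij) (hK i j)
  have e : ∀ i, rowSum (scaling K 0) i = colSum (scaling K 0) i := by
    intro i
    rw [scaling_zero, rowSum, colSum, Finset.sum_eq_single i, Finset.sum_eq_single i]
    · exact fun j _ hj => hd' j i hj
    · simp
    · exact fun j _ hj => hd' i j hj.symm
    · simp
  simp [imbalance, e] at h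

/-- An unbalanced balanceable matrix has two distinct nonzero entries: an edge `i → j` with
`i ≠ j` and an edge that leaves `j`. -/
theorem two_le_condNumber (hK : ∀ i j, 0 ≤ K i j) (h0 : K ≠ 0) (hb : Balanceable K)
    (h : 0 < imbalance K 0) : 2 ≤ condNumber K := by
  obtain ⟨i, j, hij, hpos⟩ := exists_offDiag_pos hK h
  obtain ⟨l, hl⟩ := (row_pos_iff_col_pos hK hb j).2 ⟨i, hpos⟩
  rw [condNumber, le_div_iff₀ (minEntry_pos hK h0)]
  have h1 : K i j ≤ ∑ l, K i l := Finset.single_le_sum (fun l _ => hK i l) (Finset.mem_univ j)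
  have h2 : K j l ≤ ∑ l, K j l := Finset.single_le_sum (fun l _ => hK j l) (Finset.mem_univ l)
  have h3 : ∑ l, K i l + ∑ l, K j l ≤ ∑ i, ∑ l, K i l := by
    rw [← Finset.sum_pair (f := fun i => ∑ l, K i l) hij]
    exact Finset.sum_le_sum_of_subset_of_nonneg (Finset.subset_univ _)
      fun i _ _ => Finset.sum_nonneg fun l _ => hK i l
  linarith [minEntry_le hpos, minEntry_le hl]

theorem imbalance_le_two (hK : ∀ i j, 0 ≤ K i j) (h0 : K ≠ 0) (x : Fin n → ℝ) :
    imbalance K x ≤ 2 := by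
  rw [imbalance, div_le_iff₀ (mass_pos hK h0 x)]
  calc _ ≤ ∑ i, (rowSum (scaling K x) i + colSum (scaling K x) i) := by
        refine Finset.sum_le_sum fun i _ => ?_
        have h1 := rowSum_scaling_nonneg hK x i
        have h2 := colSum_scaling_nonneg hK x i
        rw [abs_le]
        constructor <;> linarith
    _ = 2 * mass K x := by
        rw [Finset.sum_add_distrib, sum_rowSum_scaling, sum_colSum_scaling]
        ring

end Parameters

section Potential

variable {n : ℕ} {K : Matrix (Fin n) (Fin n) ℝ}

/-- The function `δ / (ε (ε + ρ δ))`, the primitive of the decreasing function `1 / (ε + ρ δ)²` that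
vanishes at `0`. It is applied to the suboptimality `δ` of an iterate, whose imbalance is at
least `(ε + ρ δ) / 2` as long as it is not `ε`-balanced. -/
noncomputable def gapPotential (ε ρ δ : ℝ) : ℝ := δ / (ε * (ε + ρ * δ))

theorem gapPotential_sub {ε ρ δ δ' : ℝ} (hε : 0 < ε) (hρ : 0 ≤ ρ) (hδ : 0 ≤ δ) (hδ' : 0 ≤ δ') :
    gapPotential ε ρ δ - gapPotential ε ρ δ' = (δ - δ') / ((ε + ρ * δ) * (ε + ρ * δ')) := by
  have h1 : 0 < ε + ρ * δ := by positivity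
  have h2 : 0 < ε + ρ * δ' := by positivity
  unfold gapPotential
  field_simp
  ring

theorem gapPotential_mono {ε ρ δ δ' : ℝ} (hε : 0 < ε) (hρ : 0 ≤ ρ) (hδ' : 0 ≤ δ')
    (h : δ' ≤ δ) : gapPotential ε ρ δ' ≤ gapPotential ε ρ δ := by
  have hδ := hδ'.trans h
  rw [← sub_nonneg, gapPotential_sub hε hρ hδ hδ']
  exact div_nonneg (sub_nonneg.2 h) (by positivity)

/-- By concavity, the potential decreases at least with the slope at the larger argument. -/
theorem div_sq_le_gapPotential_sub {ε ρ δ δ' g : ℝ} (hε : 0 < ε) (hρ : 0 ≤ ρ) (hδ' : 0 ≤ δ')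
    (h : δ' ≤ δ) (hg : ε ≤ g) (hρg : ρ * δ ≤ g) :
    (δ - δ') / (2 * g) ^ 2 ≤ gapPotential ε ρ δ - gapPotential ε ρ δ' := by
  have hδ := hδ'.trans h
  rw [gapPotential_sub hε hρ hδ hδ']
  have h1 : ρ * δ' ≤ ρ * δ := by gcongr
  have h2 : 0 ≤ ρ * δ' := by positivity
  have h3 := sub_nonneg.2 h
  rw [sq]
  gcongr <;> linarith

/-- One random update decreases the potential by at least `1 / (16 n)` on average, as long as the
iterate is not `ε`-balanced. -/
theorem sum_gapPotential_sub (hK : ∀ i j, 0 ≤ K i j) (h0 : K ≠ 0) {z : Fin n → ℝ}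
    (hz : IsBalanced (scaling K z)) {ε ρ : ℝ} (hε : 0 < ε) (hρ : 0 ≤ ρ) {x : Fin n → ℝ}
    (hx : ε < imbalance K x)
    (hρx : ρ * (Real.log (mass K x) - Real.log (mass K z)) ≤ imbalance K x) :
    1 / 16 ≤ ∑ k, (gapPotential ε ρ (Real.log (mass K x) - Real.log (mass K z))
      - gapPotential ε ρ (Real.log (mass K (update K x k).val) - Real.log (mass K z))) := by
  have hg : 0 < imbalance K x := hε.trans hx
  have h1 := sq_imbalance_le_sum_log_sub hK h0 ⟨z, hz⟩ x
  calc (1 : ℝ) / 16 = (imbalance K x ^ 2 / 4) / (2 * imbalance K x) ^ 2 := by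
        field_simp
        norm_num
    _ ≤ (∑ k, (Real.log (mass K x) - Real.log (mass K (update K x k).val)))
        / (2 * imbalance K x) ^ 2 := by gcongr
    _ = ∑ k, ((Real.log (mass K x) - Real.log (mass K z))
          - (Real.log (mass K (update K x k).val) - Real.log (mass K z)))
        / (2 * imbalance K x) ^ 2 := by
        rw [Finset.sum_div]
        exact Finset.sum_congr rfl fun k _ => by ring
    _ ≤ _ := by
        refine Finset.sum_le_sum fun k _ => ?_
        refine div_sq_le_gapPotential_sub hε hρ ?_ ?_ hx.le hρx
        · exact sub_nonneg.2 (Real.log_le_log (mass_pos hK h0 z) (mass_le_of_isBalanced hK h0 hz _))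
        · exact sub_le_sub_right (Real.log_le_log (mass_pos hK h0 _)
            (mass_update_le_mass hK ⟨z, hz⟩ x k)) _

/-- If the suboptimality times `ρ` is bounded by the imbalance, the normalized potential takes
values in `[0, 1]` and decreases on average by a constant over `n Q`. -/
theorem exists_potential_of_rho (hK : ∀ i j, 0 ≤ K i j) (h0 : K ≠ 0) {z : Fin n → ℝ}
    (hz : IsBalanced (scaling K z)) {ε ρ Q : ℝ} (hε : 0 < ε) (hρ : 0 ≤ ρ) (hQ : 0 < Q)
    (hρx : ∀ x, mass K x ≤ mass K 0 →
      ρ * (Real.log (mass K x) - Real.log (mass K z)) ≤ imbalance K x)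
    (hQb : gapPotential ε ρ (Real.log (condNumber K)) ≤ Q) :
    ∃ W : (Fin n → ℝ) → ℝ, (∀ x, mass K x ≤ mass K 0 → 0 ≤ W x ∧ W x ≤ 1) ∧
      ∀ x, mass K x ≤ mass K 0 → ε < imbalance K x →
        1 / (16 * Q) ≤ ∑ k, (W x - W (update K x k).val) := by
  refine ⟨fun x => gapPotential ε ρ (Real.log (mass K x) - Real.log (mass K z)) / Q, ?_, ?_⟩
  · intro x hx
    have h1 : 0 ≤ Real.log (mass K x) - Real.log (mass K z) :=
      sub_nonneg.2 (Real.log_le_log (mass_pos hK h0 z) (mass_le_of_isBalanced hK h0 hz _))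
    have h2 : Real.log (mass K x) - Real.log (mass K z) ≤ Real.log (condNumber K) :=
      (sub_le_sub_right (Real.log_le_log (mass_pos hK h0 x) hx) _).trans
        (log_mass_zero_sub_le hK h0 hz)
    refine ⟨div_nonneg ?_ hQ.le, ?_⟩
    · unfold gapPotential
      positivity
    · rw [div_le_one hQ]
      exact (gapPotential_mono hε hρ h1 h2).trans hQb
  · intro x hx hxε
    have h := sum_gapPotential_sub hK h0 hz hε hρ hxε (hρx x hx)
    simp only [← sub_div]
    rw [← Finset.sum_div, ← div_div]
    gcongr

/-- The potential of Random Osborne. The number `q` is `(1 / ε) (1 / ε ∧ d) log κ`. -/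
theorem exists_potential (hK : ∀ i j, 0 ≤ K i j) (h0 : K ≠ 0) (hb : Balanceable K) {ε : ℝ}
    (hε : 0 < ε) (hnb : ε < imbalance K 0) :
    ∃ q : ℝ, 1 / 8 ≤ q ∧ rate K ε = ENNReal.ofReal (nnz K * q) ∧
      ∃ W : (Fin n → ℝ) → ℝ, (∀ x, mass K x ≤ mass K 0 → 0 ≤ W x ∧ W x ≤ 1) ∧
        ∀ x, mass K x ≤ mass K 0 → ε < imbalance K x →
          1 / (32 * q) ≤ ∑ k, (W x - W (update K x k).val) := by
  have hκ := two_le_condNumber hK h0 hb (hε.trans hnb)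
  obtain ⟨z, hz⟩ := hb
  have hε2 : ε < 2 := hnb.trans_le (imbalance_le_two hK h0 0)
  have hL : 1 / 2 ≤ Real.log (condNumber K) :=
    le_trans (by linarith [Real.log_two_gt_d9]) (Real.log_le_log (by norm_num) hκ)
  set L := Real.log (condNumber K) with hLdef
  have hε' : 1 / 2 ≤ 1 / ε := one_div_le_one_div_of_le hε hε2.le
  -- `b` stands for `1 / ε ∧ d`
  have main : ∀ b ρ : ℝ, 1 / 2 ≤ b → 0 ≤ ρ →
      min (1 / ENNReal.ofReal ε) (graphDiam K : ℝ≥0∞) = ENNReal.ofReal b →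
      (∀ x, mass K x ≤ mass K 0 →
        ρ * (Real.log (mass K x) - Real.log (mass K z)) ≤ imbalance K x) →
      1 ≤ 2 * b * (ε + ρ * L) →
      ∃ q : ℝ, 1 / 8 ≤ q ∧ rate K ε = ENNReal.ofReal (nnz K * q) ∧
      ∃ W : (Fin n → ℝ) → ℝ, (∀ x, mass K x ≤ mass K 0 → 0 ≤ W x ∧ W x ≤ 1) ∧
        ∀ x, mass K x ≤ mass K 0 → ε < imbalance K x →
          1 / (32 * q) ≤ ∑ k, (W x - W (update K x k).val) := by
    intro b ρ hb hρ hmin hρx hbρ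
    have hq : 1 / 8 ≤ 1 / ε * b * L := by
      calc (1 : ℝ) / 8 = 1 / 2 * (1 / 2) * (1 / 2) := by norm_num
        _ ≤ _ := by gcongr
    refine ⟨1 / ε * b * L, hq, ?_, ?_⟩
    · rw [rate, hmin, ← ENNReal.ofReal_natCast, ← ENNReal.ofReal_div_of_pos hε,
        ← ENNReal.ofReal_mul (by positivity), ← ENNReal.ofReal_mul (by positivity)]
      congr 1
      ring
    · have h := exists_potential_of_rho hK h0 hz (Q := 2 * (1 / ε * b * L)) hε hρ (by linarith)
        hρx ?_
      · rw [← mul_assoc] at h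
        norm_num at h ⊢
        exact h
      · have h1 : 0 ≤ ρ * L := by positivity
        rw [gapPotential, div_le_iff₀ (by positivity)]
        have e : 2 * (1 / ε * b * L) * (ε * (ε + ρ * L)) = L * (2 * b * (ε + ρ * L)) := by
          field_simp
        rw [e]
        exact le_mul_of_one_le_right (by linarith) hbρ
  rcases hd : graphDiam K with _ | D
  · have hd' : graphDiam K = ⊤ := hd
    refine main (1 / ε) 0 hε' le_rfl ?_ (fun x _ => ?_) ?_
    · rw [hd', ENNReal.ofReal_div_of_pos hε]
      simp
    · rw [zero_mul, imbalance]
      exact div_nonneg (Finset.sum_nonneg fun i _ => abs_nonneg _) (mass_pos hK h0 x).le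
    · rw [zero_mul, add_zero, mul_assoc, one_div_mul_cancel hε.ne']
      norm_num
  · have hd' : graphDiam K = (D : ℕ∞) := hd
    have hD : 1 ≤ D := by
      obtain ⟨i, j, hij, -⟩ := exists_offDiag_pos hK (hε.trans hnb)
      obtain ⟨l, hl, p, hp, hp', -⟩ := exists_hasWalk_of_graphDiam_eq hd' i j
      refine le_trans (Nat.one_le_iff_ne_zero.2 ?_) hl
      rintro rfl
      exact hij (hp.symm.trans hp')
    have hD' : (1 : ℝ) ≤ D := by exact_mod_cast hD
    have hDL : 0 < 2 * (D * L) := by positivity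
    refine main (min (1 / ε) D) (1 / (2 * (D * L))) (le_min hε' (by linarith)) (by positivity)
      ?_ (fun x hx => ?_) ?_
    · rw [hd', (ENNReal.ofReal_mono).map_min, ENNReal.ofReal_div_of_pos hε]
      simp
    · rw [div_mul_eq_mul_div, one_mul, div_le_iff₀ hDL, mul_comm]
      refine log_mass_sub_le hK h0 fun i j => ?_
      have osc : ∀ y : Fin n → ℝ, mass K y ≤ mass K 0 → ∀ i j, y i - y j ≤ D * L := by
        intro y hy i j
        obtain ⟨l, hl, hw⟩ := exists_hasWalk_of_graphDiam_eq hd' i j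
        refine (sub_le_of_hasWalk hK h0 hy hw).trans ?_
        have : (l : ℝ) ≤ D := by exact_mod_cast hl
        gcongr
      linarith [osc x hx i j, osc z (mass_le_of_isBalanced hK h0 hz 0) j i]
    · have e : 1 / (2 * (D * L)) * L = 1 / (2 * D) := by field_simp
      rw [e]
      rcases min_choice (1 / ε) (D : ℝ) with h | h <;> rw [h]
      · have : 2 * (1 / ε) * (ε + 1 / (2 * D)) = 2 + 1 / (ε * D) := by field_simp
        rw [this]
        have : 0 < 1 / (ε * D) := by positivity
        linarith
      · have : 2 * (D : ℝ) * (ε + 1 / (2 * D)) = 2 * D * ε + 1 := by field_simp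
        rw [this]
        have : 0 < 2 * D * ε := by positivity
        linarith

end Potential

end Osborne

/-! ### Exponential moments of the stopped cost -/

namespace Osborne

section RandomSequences

variable {n : ℕ} {Ω : Type*} [MeasurableSpace Ω] {P : Measure Ω} {k : ℕ → Ω → Fin n}

theorem measurable_of_dependsOn (hk : ∀ t, Measurable (k t)) {t : ℕ} {G : (ℕ → Fin n) → ℝ≥0∞}
    (hG : DependsOn G (Set.Iio t)) : Measurable fun ω => G fun s => k s ω := by
  rcases isEmpty_or_nonempty Ω with hΩ | ⟨⟨ω₀⟩⟩
  · exact measurable_of_empty _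
  have e : (fun ω => G fun s => k s ω)
      = (fun p : Finset.range t → Fin n =>
          G fun s => if h : s ∈ Finset.range t then p ⟨s, h⟩ else k s ω₀)
        ∘ fun ω (s : Finset.range t) => k s ω := by
    ext ω
    refine hG fun s hs => ?_
    simp [show s < t from hs]
  rw [e]
  exact (measurable_of_countable _).comp (measurable_pi_lambda _ fun s => hk s)

/-- A function of the draws before time `t` is independent of the draw at time `t`. -/
theorem indepFun_of_dependsOn [IsProbabilityMeasure P] (hk : ∀ t, Measurable (k t)) (hi : iIndepFun k P) {t : ℕ}
    {G : (ℕ → Fin n) → ℝ≥0∞} (hG : DependsOn G (Set.Iio t)) :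
    IndepFun (fun ω => G fun s => k s ω) (k t) P := by
  obtain ⟨ω₀⟩ := P.nonempty_of_neZero
  have h := hi.indepFun_finset (Finset.range t) {t} (by simp) hk
  have h2 := h.comp (φ := fun p : Finset.range t → Fin n =>
          G fun s => if h : s ∈ Finset.range t then p ⟨s, h⟩ else k s ω₀)
        (ψ := fun p : ({t} : Finset ℕ) → Fin n => p ⟨t, Finset.mem_singleton_self t⟩)
        (measurable_of_countable _)
        (measurable_of_countable _)
  refine h2.congr (Filter.Eventually.of_forall fun ω => Eq.symm ?_)
    (Filter.Eventually.of_forall fun ω => rfl)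
  refine hG fun s hs => ?_
  simp [show s < t from hs]

/-- If averaging `Y'` over the draw at time `t` gives at most `Y`, which depends on the earlier
draws only, then the expectation of `Y'` is at most that of `Y`. -/
theorem lintegral_le_of_sum_update_le [IsProbabilityMeasure P] (hk : ∀ t, Measurable (k t))
    (hi : iIndepFun k P) (hu : ∀ t i, P (k t ⁻¹' {i}) = 1 / (n : ℝ≥0∞)) {t : ℕ}
    {Y Y' : (ℕ → Fin n) → ℝ≥0∞} (hY' : DependsOn Y' (Set.Iio (t + 1)))
    (h : ∀ κ, ∑ i, Y' (Function.update κ t i) ≤ n * Y κ) :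
    ∫⁻ ω, Y' (fun s => k s ω) ∂P ≤ ∫⁻ ω, Y (fun s => k s ω) ∂P := by
  have hn : (n : ℝ≥0∞) ≠ 0 := by
    obtain ⟨ω₀⟩ := P.nonempty_of_neZero
    have := (k 0 ω₀).pos
    exact_mod_cast this.ne'
  have hG : ∀ i, DependsOn (fun κ => Y' (Function.update κ t i)) (Set.Iio t) := by
    intro i κ κ' hκ
    refine hY' fun s hs => ?_
    rcases eq_or_ne s t with rfl | hst
    · simp
    · simp only [Function.update_of_ne hst]
      exact hκ s (lt_of_le_of_ne (Nat.lt_succ_iff.1 hs) hst)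
  have hsplit : ∀ ω, Y' (fun s => k s ω)
      = ∑ i, Y' (Function.update (fun s => k s ω) t i) * (k t ⁻¹' {i}).indicator 1 ω := by
    intro ω
    rw [Finset.sum_eq_single (k t ω)]
    · simp
    · intro i _ hi
      simp [hi.symm]
    · simp
  have hint : ∀ i, ∫⁻ ω, Y' (Function.update (fun s => k s ω) t i)
        * (k t ⁻¹' {i}).indicator 1 ω ∂P
      = (∫⁻ ω, Y' (Function.update (fun s => k s ω) t i) ∂P) * (1 / (n : ℝ≥0∞)) := by
    intro i
    have hm : MeasurableSet (k t ⁻¹' {i}) := hk t (measurableSet_singleton i)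
    rw [← hu t i, ← lintegral_indicator_one hm]
    refine lintegral_mul_eq_lintegral_mul_lintegral_of_indepFun
      (measurable_of_dependsOn hk (hG i)) (measurable_one.indicator hm) ?_
    exact (indepFun_of_dependsOn hk hi (hG i)).comp (φ := id)
      (ψ := ({i} : Set (Fin n)).indicator 1) measurable_id (measurable_of_countable _)
  calc ∫⁻ ω, Y' (fun s => k s ω) ∂P
      = ∑ i, (∫⁻ ω, Y' (Function.update (fun s => k s ω) t i) ∂P) * (1 / (n : ℝ≥0∞)) := by
        simp only [hsplit]
        rw [lintegral_finsetSum]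
        · exact Finset.sum_congr rfl fun i _ => hint i
        · exact fun i _ => (measurable_of_dependsOn hk (hG i)).mul
            (measurable_one.indicator (hk t (measurableSet_singleton i)))
    _ = (∫⁻ ω, ∑ i, Y' (Function.update (fun s => k s ω) t i) ∂P) * (1 / (n : ℝ≥0∞)) := by
        rw [lintegral_finsetSum _ fun i _ => measurable_of_dependsOn hk (hG i), Finset.sum_mul]
    _ ≤ (∫⁻ ω, n * Y (fun s => k s ω) ∂P) * (1 / (n : ℝ≥0∞)) := by
        gcongr with ω
        exact h _
    _ = ∫⁻ ω, Y (fun s => k s ω) ∂P := by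
        rw [lintegral_const_mul' _ _ (ENNReal.natCast_ne_top n), mul_right_comm, one_div,
          ENNReal.mul_inv_cancel hn (ENNReal.natCast_ne_top n), one_mul]

end RandomSequences

section StoppedCost

variable {n : ℕ} (K : Matrix (Fin n) (Fin n) ℝ) (ε : ℝ)

/-- None of the first `t` iterates is `ε`-balanced, so that at least `t` updates are performed. -/
def Running (κ : ℕ → Fin n) (t : ℕ) : Prop :=
  ∀ u < t, ¬ IsEpsBalanced ε (scaling K (iterate K κ u))

open Classical in
/-- The cost of those among the first `t` updates that are performed, if an update on coordinate
`i` costs `y i`. -/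
noncomputable def stoppedCost (y : Fin n → ℝ) (κ : ℕ → Fin n) (t : ℕ) : ℝ :=
  ∑ s ∈ Finset.range t, if Running K ε κ (s + 1) then y (κ s) else 0

theorem dependsOn_iterate (t : ℕ) : DependsOn (fun κ => iterate K κ t) (Set.Iio t) := by
  induction t with
  | zero => exact fun _ _ _ => rfl
  | succ t ih =>
    intro κ κ' h
    have h1 : iterate K κ t = iterate K κ' t := ih fun i hi => h i (Nat.lt_succ_of_lt hi)
    simp only [iterate, h1, h t (Nat.lt_succ_self t)]

theorem dependsOn_running (t : ℕ) : DependsOn (fun κ => Running K ε κ (t + 1)) (Set.Iio t) := by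
  intro κ κ' h
  refine propext <| forall₂_congr fun u hu => ?_
  rw [show iterate K κ u = iterate K κ' u from
    dependsOn_iterate K u fun i hi => h i (lt_of_lt_of_le hi (Nat.lt_succ_iff.1 hu))]

theorem dependsOn_stoppedCost (y : Fin n → ℝ) (t : ℕ) :
    DependsOn (fun κ => stoppedCost K ε y κ t) (Set.Iio t) := by
  classical
  intro κ κ' h
  refine Finset.sum_congr rfl fun s hs => ?_
  have hs := Finset.mem_range.1 hs
  have h1 : Running K ε κ (s + 1) = Running K ε κ' (s + 1) :=
    dependsOn_running K ε s fun i hi => h i (lt_trans hi hs)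
  rw [h s hs]
  exact if_congr (iff_of_eq h1) rfl rfl

variable {K ε}

theorem stoppedCost_succ (y : Fin n → ℝ) (κ : ℕ → Fin n) (t : ℕ)
    [Decidable (Running K ε κ (t + 1))] :
    stoppedCost K ε y κ (t + 1)
      = stoppedCost K ε y κ t + if Running K ε κ (t + 1) then y (κ t) else 0 := by
  rw [stoppedCost, Finset.sum_range_succ]
  congr

theorem stoppedCost_of_running (y : Fin n → ℝ) {κ : ℕ → Fin n} {t : ℕ} (h : Running K ε κ t) :
    stoppedCost K ε y κ t = ∑ s ∈ Finset.range t, y (κ s) :=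
  Finset.sum_congr rfl fun _ hs => if_pos fun u hu =>
    h u (lt_of_lt_of_le hu (Finset.mem_range.1 hs))

theorem stoppedCost_mono {y : Fin n → ℝ} (hy : ∀ i, 0 ≤ y i) (κ : ℕ → Fin n) :
    Monotone (stoppedCost K ε y κ) := by
  classical
  refine monotone_nat_of_le_succ fun t => ?_
  rw [stoppedCost_succ]
  split_ifs
  · exact le_add_of_nonneg_right (hy _)
  · simp

theorem mass_iterate_le (hK : ∀ i j, 0 ≤ K i j) (hb : Balanceable K) (κ : ℕ → Fin n) (t : ℕ) :
    mass K (iterate K κ t) ≤ mass K 0 := by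
  induction t with
  | zero => exact le_rfl
  | succ t ih => exact (mass_update_le_mass hK hb _ _).trans ih

/-- The exponential supermartingale inequality for one step: a cost of mean at most a quarter
of the mean decrease of the potential `W` is absorbed by the factor `1 + W`. -/
theorem sum_exp_mul_le {y W' : Fin n → ℝ} {w : ℝ} (hy : ∀ i, 0 ≤ y i) (hy1 : ∀ i, y i ≤ 1)
    (hW' : ∀ i, 0 ≤ W' i) (hW1 : ∀ i, W' i ≤ 1) (h : 4 * ∑ i, y i ≤ ∑ i, (w - W' i)) :
    ∑ i, Real.exp (y i) * (1 + W' i) ≤ n * (1 + w) := by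
  have h1 : ∀ i, Real.exp (y i) * (1 + W' i) ≤ (1 + W' i) + 4 * y i := by
    intro i
    have h2 : Real.exp (y i) ≤ 1 + 2 * y i := by
      have := abs_le.1 (Real.abs_exp_sub_one_sub_id_le (abs_le.2 ⟨by linarith [hy i], hy1 i⟩))
      nlinarith [hy i, hy1 i]
    nlinarith [hy i, hW' i, hW1 i]
  calc ∑ i, Real.exp (y i) * (1 + W' i) ≤ ∑ i, ((1 + W' i) + 4 * y i) :=
        Finset.sum_le_sum fun i _ => h1 i
    _ = n + ∑ i, W' i + 4 * ∑ i, y i := by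
        simp [Finset.sum_add_distrib, Finset.mul_sum]
    _ ≤ n + ∑ i, W' i + ∑ i, (w - W' i) := by gcongr
    _ = n * (1 + w) := by
        simp [Finset.sum_sub_distrib]
        ring

variable {Ω : Type*} [MeasurableSpace Ω] {P : Measure Ω} [IsProbabilityMeasure P]
  {k : ℕ → Ω → Fin n}

/-- The exponential moment of the stopped cost, for a cost that is controlled by the decrease of
a potential `W` with values in `[0, 1]`. -/
theorem lintegral_exp_stoppedCost_le (hK : ∀ i j, 0 ≤ K i j) (hb : Balanceable K)
    (hk : ∀ t, Measurable (k t)) (hi : iIndepFun k P)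
    (hu : ∀ t i, P (k t ⁻¹' {i}) = 1 / (n : ℝ≥0∞)) {y : Fin n → ℝ}
    (hy : ∀ i, 0 ≤ y i) (hy1 : ∀ i, y i ≤ 1) {W : (Fin n → ℝ) → ℝ}
    (hW : ∀ x, mass K x ≤ mass K 0 → 0 ≤ W x ∧ W x ≤ 1)
    (hstep : ∀ x, mass K x ≤ mass K 0 → ε < imbalance K x →
      4 * ∑ i, y i ≤ ∑ i, (W x - W (update K x i).val)) (t : ℕ) :
    ∫⁻ ω, ENNReal.ofReal (Real.exp (stoppedCost K ε y (fun s => k s ω) t)) ∂P ≤ 2 := by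
  classical
  set Y : ℕ → (ℕ → Fin n) → ℝ≥0∞ := fun t κ => ENNReal.ofReal
    (Real.exp (stoppedCost K ε y κ t) * (1 + if Running K ε κ t then W (iterate K κ t) else 0))
    with hYdef
  have hYdep : ∀ t, DependsOn (Y t) (Set.Iio t) := by
    intro t κ κ' h
    have h1 : stoppedCost K ε y κ t = stoppedCost K ε y κ' t := dependsOn_stoppedCost K ε y t h
    have h2 : iterate K κ t = iterate K κ' t := dependsOn_iterate K t h
    have h3 : Running K ε κ t = Running K ε κ' t := by
      refine propext <| forall₂_congr fun u hu => ?_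
      rw [show iterate K κ u = iterate K κ' u from
        dependsOn_iterate K u fun i hi => h i (lt_trans hi hu)]
    simp only [hYdef, h1, h2, h3]
  have hYstep : ∀ t κ, ∑ i, Y (t + 1) (Function.update κ t i) ≤ n * Y t κ := by
    intro t κ
    have hagree : ∀ i, ∀ s ∈ Set.Iio t, Function.update κ t i s = κ s := fun i s hs =>
      Function.update_of_ne (ne_of_lt hs) _ _
    have h1 : ∀ i, stoppedCost K ε y (Function.update κ t i) t = stoppedCost K ε y κ t :=
      fun i => dependsOn_stoppedCost K ε y t (hagree i)
    have h2 : ∀ i, Running K ε (Function.update κ t i) (t + 1) = Running K ε κ (t + 1) :=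
      fun i => dependsOn_running K ε t (hagree i)
    have h3 : ∀ i, iterate K (Function.update κ t i) (t + 1)
        = (update K (iterate K κ t) i).val := by
      intro i
      rw [iterate, Function.update_self,
        show iterate K (Function.update κ t i) t = iterate K κ t from
          dependsOn_iterate K t (hagree i)]
    simp only [hYdef, stoppedCost_succ, h1, h2, h3, Function.update_self]
    have hm := mass_iterate_le hK hb κ t
    by_cases hrun : Running K ε κ (t + 1)
    · have hrun' : Running K ε κ t := fun u hu => hrun u (Nat.lt_succ_of_lt hu)
      have hε : ε < imbalance K (iterate K κ t) :=
        not_le.1 fun h => hrun t (Nat.lt_succ_self t) h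
      simp only [if_pos hrun, if_pos hrun']
      have hW' : ∀ i, 0 ≤ W (update K (iterate K κ t) i).val ∧
          W (update K (iterate K κ t) i).val ≤ 1 :=
        fun i => hW _ ((mass_update_le_mass hK hb _ _).trans hm)
      have h4 := sum_exp_mul_le hy hy1 (fun i => (hW' i).1) (fun i => (hW' i).2) (hstep _ hm hε)
      rw [← ENNReal.ofReal_sum_of_nonneg fun i _ => mul_nonneg (Real.exp_pos _).le
        (by linarith [(hW' i).1]), ← ENNReal.ofReal_natCast,
        ← ENNReal.ofReal_mul (Nat.cast_nonneg n)]
      refine ENNReal.ofReal_le_ofReal ?_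
      simp only [Real.exp_add, mul_assoc, ← Finset.mul_sum]
      rw [mul_left_comm]
      gcongr
    · simp only [if_neg hrun, add_zero, mul_one, Finset.sum_const, Finset.card_univ,
        Fintype.card_fin, nsmul_eq_mul]
      gcongr
      refine le_mul_of_one_le_right (Real.exp_pos _).le (le_add_of_nonneg_right ?_)
      split_ifs
      · exact (hW _ hm).1
      · exact le_rfl
  have hY : ∀ t, ∫⁻ ω, Y t (fun s => k s ω) ∂P ≤ 2 := by
    intro t
    induction t with
    | zero =>
      refine (lintegral_mono (g := fun _ => 2) fun ω => ?_).trans (by simp)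
      have h := hW 0 le_rfl
      simp only [hYdef, stoppedCost, Finset.range_zero, Finset.sum_empty, Real.exp_zero, one_mul]
      rw [show (2 : ℝ≥0∞) = ENNReal.ofReal 2 by simp]
      refine ENNReal.ofReal_le_ofReal ?_
      split_ifs
      · rw [iterate]
        linarith
      · norm_num
    | succ t ih => exact (lintegral_le_of_sum_update_le hk hi hu (hYdep _) (hYstep t)).trans ih
  refine (lintegral_mono fun ω => ENNReal.ofReal_le_ofReal ?_).trans (hY t)
  refine le_mul_of_one_le_right (Real.exp_pos _).le (le_add_of_nonneg_right ?_)
  split_ifs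
  · exact (hW _ (mass_iterate_le hK hb _ t)).1
  · exact le_rfl

end StoppedCost

end Osborne

/-! ### Counting operations -/

namespace Osborne

section OperationCount

variable {n : ℕ} {K : Matrix (Fin n) (Fin n) ℝ}

theorem sum_length_rowList (K : Matrix (Fin n) (Fin n) ℝ) :
    ∑ k, (rowList K k).length = nnz K := by
  classical
  have h : ∀ k, (rowList K k).length = ∑ j, if K k j ≠ 0 then 1 else 0 := by
    intro k
    rw [rowList, ← Finset.card_filter,
      ← List.toFinset_card_of_nodup ((List.nodup_finRange n).filter _)]
    congr 1
    ext
    simp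
  rw [nnz, Set.ncard_eq_toFinset_card', Set.toFinset_ofPred, Finset.card_filter,
    Fintype.sum_prod_type]
  exact Finset.sum_congr rfl fun k _ => h k

theorem sum_length_colList (K : Matrix (Fin n) (Fin n) ℝ) :
    ∑ k, (colList K k).length = nnz K := by
  classical
  have h : ∀ k, (colList K k).length = ∑ i, if K i k ≠ 0 then 1 else 0 := by
    intro k
    rw [colList, ← Finset.card_filter,
      ← List.toFinset_card_of_nodup ((List.nodup_finRange n).filter _)]
    congr 1
    ext
    simp
  rw [nnz, Set.ncard_eq_toFinset_card', Set.toFinset_ofPred, Finset.card_filter,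
    Fintype.sum_prod_type_right]
  exact Finset.sum_congr rfl fun k _ => h k

theorem nnz_pos (h0 : K ≠ 0) : 0 < nnz K := by
  rw [nnz, Set.ncard_pos]
  by_contra! h
  refine h0 (Matrix.ext fun i j => ?_)
  by_contra hij
  exact Set.eq_empty_iff_forall_notMem.1 h (i, j) hij

theorem stepOps_le (κ : ℕ → Fin n) (t : ℕ) :
    stepOps K κ t ≤ 9 * (rowList K (κ t)).length + 4 * (colList K (κ t)).length := by
  rw [stepOps]
  by_cases h : rowList K (κ t) = [] ∨ colList K (κ t) = []
  · rw [update, if_pos h, ops_pure]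
    exact Nat.zero_le _
  · rw [not_or] at h
    rw [update_ops K _ _ h.1 h.2]
    have := List.length_pos_iff.2 h.1
    omega

/-- An upper bound of the number of operations of an update on coordinate `i`, increased by
`m / n` so that every update has a positive cost, whether or not it performs operations. -/
noncomputable def updateCost (K : Matrix (Fin n) (Fin n) ℝ) (i : Fin n) : ℝ :=
  9 * (rowList K i).length + 4 * (colList K i).length + nnz K / n

theorem sum_updateCost (h0 : K ≠ 0) : ∑ i, updateCost K i = 14 * nnz K := by
  have hn : (n : ℝ) ≠ 0 := by
    rintro h
    have : n = 0 := by exact_mod_cast h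
    subst this
    exact h0 (by ext i; exact i.elim0)
  simp only [updateCost, Finset.sum_add_distrib, ← Finset.mul_sum, Finset.sum_const,
    Finset.card_univ, Fintype.card_fin, nsmul_eq_mul]
  rw [← Nat.cast_sum, ← Nat.cast_sum, sum_length_rowList, sum_length_colList,
    mul_div_cancel₀ _ hn]
  ring

theorem updateCost_nonneg (i : Fin n) : 0 ≤ updateCost K i := by
  unfold updateCost
  positivity

theorem nnz_div_le_updateCost (i : Fin n) : (nnz K : ℝ) / n ≤ updateCost K i := by
  unfold updateCost
  have : (0 : ℝ) ≤ 9 * (rowList K i).length + 4 * (colList K i).length := by positivity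
  linarith

theorem stepOps_le_updateCost (κ : ℕ → Fin n) (t : ℕ) :
    (stepOps K κ t : ℝ) ≤ updateCost K (κ t) := by
  have h : (stepOps K κ t : ℝ) ≤ 9 * (rowList K (κ t)).length + 4 * (colList K (κ t)).length := by
    exact_mod_cast stepOps_le κ t
  refine h.trans ?_
  unfold updateCost
  have : (0 : ℝ) ≤ (nnz K : ℝ) / n := by positivity
  linarith

/-- The supremum over time of the exponential of `μ` times the stopped cost. -/
noncomputable def expCost (K : Matrix (Fin n) (Fin n) ℝ) (ε μ : ℝ) (κ : ℕ → Fin n) : ℝ≥0∞ :=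
  ⨆ t, ENNReal.ofReal (Real.exp (stoppedCost K ε (fun i => μ * updateCost K i) κ t))

theorem expCost_eq_top (h0 : K ≠ 0) {ε μ : ℝ} (hμ : 0 < μ) {κ : ℕ → Fin n}
    (h : ¬ ∃ t, IsEpsBalanced ε (scaling K (iterate K κ t))) : expCost K ε μ κ = ∞ := by
  push Not at h
  have hn : (0 : ℝ) < n := by exact_mod_cast (κ 0).pos
  have hm : (0 : ℝ) < nnz K := by exact_mod_cast nnz_pos h0
  have ha : 0 < μ * (nnz K / n) := by positivity
  rw [expCost, iSup_eq_top]
  intro b hb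
  obtain ⟨N, hN⟩ := exists_nat_ge (b.toReal / (μ * (nnz K / n)))
  rw [div_le_iff₀ ha] at hN
  refine ⟨N, ?_⟩
  rw [← ENNReal.ofReal_toReal hb.ne, ENNReal.ofReal_lt_ofReal_iff (Real.exp_pos _)]
  have h1 : N * (μ * (nnz K / n)) ≤ stoppedCost K ε (fun i => μ * updateCost K i) κ N := by
    have h2 := Finset.card_nsmul_le_sum (Finset.range N) (fun s => μ * updateCost K (κ s))
      (μ * (nnz K / n)) fun s _ => mul_le_mul_of_nonneg_left (nnz_div_le_updateCost _) hμ.le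
    rw [Finset.card_range, nsmul_eq_mul] at h2
    rwa [stoppedCost_of_running _ fun u _ => h u]
  linarith [Real.add_one_le_exp (stoppedCost K ε (fun i => μ * updateCost K i) κ N)]

/-- The total number `T` of operations satisfies `e^{μ a} < e^{μ T}` if `a < T`, and the right hand
side is at most `expCost`. -/
theorem exp_lt_expCost_of_lt_totalOps (h0 : K ≠ 0) {ε μ a : ℝ} (hμ : 0 < μ) {κ : ℕ → Fin n}
    (h : ENNReal.ofReal a < totalOps K ε κ) :
    ENNReal.ofReal (Real.exp (μ * a)) < expCost K ε μ κ := by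
  classical
  by_cases hex : ∃ t, IsEpsBalanced ε (scaling K (iterate K κ t))
  · refine lt_of_lt_of_le ?_ (le_iSup (fun t => ENNReal.ofReal
      (Real.exp (stoppedCost K ε (fun i => μ * updateCost K i) κ t))) (Nat.find hex))
    rw [ENNReal.ofReal_lt_ofReal_iff (Real.exp_pos _), Real.exp_lt_exp,
      stoppedCost_of_running _ fun u hu => Nat.find_min hex hu, ← Finset.mul_sum]
    rw [totalOps, dif_pos hex, ← ENNReal.ofReal_natCast] at h
    have h2 := lt_of_not_ge fun h' => h.not_ge (ENNReal.ofReal_le_ofReal h')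
    refine mul_lt_mul_of_pos_left (lt_of_lt_of_le h2 ?_) hμ
    rw [Nat.cast_sum]
    refine (Finset.sum_le_sum fun s _ => stepOps_le_updateCost κ s).trans (le_of_eq ?_)
    congr
  · rw [expCost_eq_top h0 hμ hex]
    exact ENNReal.ofReal_lt_top

theorem totalOps_le_expCost (h0 : K ≠ 0) {ε μ : ℝ} (hμ : 0 < μ) (κ : ℕ → Fin n) :
    totalOps K ε κ ≤ ENNReal.ofReal (1 / μ) * expCost K ε μ κ := by
  refine le_of_forall_lt fun b hb => ?_
  have hb' : b ≠ ∞ := hb.ne_top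
  rw [← ENNReal.ofReal_toReal hb'] at hb ⊢
  have h := exp_lt_expCost_of_lt_totalOps h0 hμ hb
  have hμ' : 0 < 1 / μ := by positivity
  calc ENNReal.ofReal b.toReal = ENNReal.ofReal (1 / μ) * ENNReal.ofReal (μ * b.toReal) := by
        rw [← ENNReal.ofReal_mul hμ'.le]
        congr 1
        field_simp
    _ ≤ ENNReal.ofReal (1 / μ) * ENNReal.ofReal (Real.exp (μ * b.toReal)) := by
        gcongr
        linarith [Real.add_one_le_exp (μ * b.toReal)]
    _ < _ := ENNReal.mul_lt_mul_right (ENNReal.ofReal_pos.2 hμ').ne' ENNReal.ofReal_ne_top h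

variable {Ω : Type*} [MeasurableSpace Ω] {P : Measure Ω} {k : ℕ → Ω → Fin n}

theorem measurable_ofReal_exp_stoppedCost (hk : ∀ t, Measurable (k t)) (ε : ℝ) (y : Fin n → ℝ)
    (t : ℕ) :
    Measurable fun ω => ENNReal.ofReal (Real.exp (stoppedCost K ε y (fun s => k s ω) t)) :=
  measurable_of_dependsOn (t := t) (G := fun κ => ENNReal.ofReal (Real.exp (stoppedCost K ε y κ t)))
    hk fun _ _ h =>
      congrArg (fun a => ENNReal.ofReal (Real.exp a)) (dependsOn_stoppedCost K ε y t h)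

theorem measurable_expCost (hk : ∀ t, Measurable (k t)) (ε μ : ℝ) :
    Measurable fun ω => expCost K ε μ (fun s => k s ω) :=
  Measurable.iSup fun t => measurable_ofReal_exp_stoppedCost hk ε _ t

/-- As long as the start is not `ε`-balanced, `expCost` has mean at most `2` for the choice of `μ`
for which `2 / μ` is the operation bound. -/
theorem exists_lintegral_expCost_le [IsProbabilityMeasure P] (hK : ∀ i j, 0 ≤ K i j) (h0 : K ≠ 0)
    (hb : Balanceable K) {ε : ℝ} (hε : 0 < ε) (hnb : ε < imbalance K 0)
    (hk : ∀ t, Measurable (k t)) (hi : iIndepFun k P)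
    (hu : ∀ t i, P (k t ⁻¹' {i}) = 1 / (n : ℝ≥0∞)) :
    ∃ μ : ℝ, 0 < μ ∧ ENNReal.ofReal 3584 * rate K ε = ENNReal.ofReal (2 / μ) ∧
      ∫⁻ ω, expCost K ε μ (fun s => k s ω) ∂P ≤ 2 := by
  obtain ⟨q, hq, hrate, W, hW, hstep⟩ := exists_potential hK h0 hb hε hnb
  have hm : (0 : ℝ) < nnz K := by exact_mod_cast nnz_pos h0
  have hq0 : 0 < q := by linarith
  have hμ : 0 < 1 / (1792 * (nnz K * q)) := by positivity
  have hsum : ∑ i, 1 / (1792 * (nnz K * q)) * updateCost K i = 1 / (128 * q) := by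
    rw [← Finset.mul_sum, sum_updateCost h0]
    field_simp
    norm_num
  have hy : ∀ i, 0 ≤ 1 / (1792 * (nnz K * q)) * updateCost K i :=
    fun i => mul_nonneg hμ.le (updateCost_nonneg i)
  refine ⟨1 / (1792 * (nnz K * q)), hμ, ?_, ?_⟩
  · rw [hrate, ← ENNReal.ofReal_mul (by norm_num)]
    congr 1
    field_simp
    norm_num
  · unfold expCost
    rw [lintegral_iSup (fun t => measurable_ofReal_exp_stoppedCost hk ε _ t)]
    · refine iSup_le fun t => lintegral_exp_stoppedCost_le hK hb hk hi hu hy (fun i => ?_) hW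
        (fun x hx hxε => ?_) t
      · refine (Finset.single_le_sum (fun i _ => hy i) (Finset.mem_univ i)).trans ?_
        rw [hsum, div_le_one (by positivity)]
        linarith
      · refine le_trans (le_of_eq ?_) (hstep x hx hxε)
        rw [hsum]
        field_simp
        norm_num
    · exact fun s t hst ω => ENNReal.ofReal_le_ofReal
        (Real.exp_le_exp.2 (stoppedCost_mono hy _ hst))

end OperationCount

end Osborne

/-! ### The convergence theorem -/

theorem theorem5p1 :
    ∃ C : ℝ, 0 < C ∧
      ∀ (n : ℕ) (K : Matrix (Fin n) (Fin n) ℝ) (ε : ℝ),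
        (∀ i j, 0 ≤ K i j) → K ≠ 0 → Osborne.Balanceable K → 0 < ε →
      -- the update coordinates are independent and uniformly distributed
      ∀ (Ω : Type*) [MeasurableSpace Ω] (P : Measure Ω) [IsProbabilityMeasure P]
        (k : ℕ → Ω → Fin n),
        (∀ t, Measurable (k t)) → iIndepFun k P →
        (∀ t i, P (k t ⁻¹' {i}) = 1 / (n : ℝ≥0∞)) →
      -- the algorithm ends almost surely, with a solution
      (∀ᵐ ω ∂P, ∃ x, Osborne.output K ε (fun t => k t ω) = some x ∧ Osborne.SolvesABAL K ε x) ∧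
      -- expectation guarantee
      (∫⁻ ω, Osborne.totalOps K ε (fun t => k t ω) ∂P
        ≤ ENNReal.ofReal C * Osborne.rate K ε) ∧
      -- high probability guarantee
      (∀ δ : ℝ, 0 < δ →
        ENNReal.ofReal (1 - δ) ≤
          P {ω | Osborne.totalOps K ε (fun t => k t ω)
            ≤ ENNReal.ofReal C * Osborne.rate K ε
              * ENNReal.ofReal (max 1 (Real.log (1 / δ)))}) := by
  classical
  refine ⟨3584, by norm_num, fun n K ε hK h0 hb hε Ω _ P _ k hk hi hu => ?_⟩
  have hout : ∀ κ : ℕ → Fin n,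
      (∃ t, Osborne.IsEpsBalanced ε (Osborne.scaling K (Osborne.iterate K κ t))) →
      ∃ x, Osborne.output K ε κ = some x ∧ Osborne.SolvesABAL K ε x := by
    intro κ hex
    refine ⟨_, ?_, Nat.find_spec hex⟩
    rw [Osborne.output, dif_pos hex]
  by_cases hnb : Osborne.imbalance K 0 ≤ ε
  · -- the algorithm stops at once
    have hex : ∀ κ : ℕ → Fin n,
        ∃ t, Osborne.IsEpsBalanced ε (Osborne.scaling K (Osborne.iterate K κ t)) :=
      fun κ => ⟨0, hnb⟩
    have hT : ∀ κ : ℕ → Fin n, Osborne.totalOps K ε κ = 0 := by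
      intro κ
      rw [Osborne.totalOps, dif_pos (hex κ), (Nat.find_eq_zero _).2 hnb]
      simp
    refine ⟨Filter.Eventually.of_forall fun ω => hout _ (hex _), by simp [hT], fun δ hδ => ?_⟩
    simp only [hT, zero_le, Set.ofPred_true, measure_univ]
    exact ENNReal.ofReal_le_one.2 (by linarith)
  obtain ⟨μ, hμ, hrate, hE⟩ :=
    Osborne.exists_lintegral_expCost_le hK h0 hb hε (not_le.1 hnb) hk hi hu
  have hmeas := Osborne.measurable_expCost (K := K) hk ε μ
  rw [hrate]
  refine ⟨?_, ?_, fun δ hδ => ?_⟩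
  · filter_upwards [ae_lt_top hmeas (hE.trans_lt ENNReal.ofNat_lt_top).ne] with ω hω
    refine hout _ ?_
    by_contra hex
    exact hω.ne (Osborne.expCost_eq_top h0 hμ hex)
  · calc ∫⁻ ω, Osborne.totalOps K ε (fun t => k t ω) ∂P
        ≤ ∫⁻ ω, ENNReal.ofReal (1 / μ) * Osborne.expCost K ε μ (fun t => k t ω) ∂P :=
          lintegral_mono fun ω => Osborne.totalOps_le_expCost h0 hμ _
      _ = ENNReal.ofReal (1 / μ) * ∫⁻ ω, Osborne.expCost K ε μ (fun t => k t ω) ∂P :=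
          lintegral_const_mul _ hmeas
      _ ≤ ENNReal.ofReal (1 / μ) * 2 := by gcongr
      _ = ENNReal.ofReal (2 / μ) := by
          rw [show (2 : ℝ≥0∞) = ENNReal.ofReal 2 by simp, ← ENNReal.ofReal_mul (by positivity)]
          congr 1
          ring
  · set M := max 1 (Real.log (1 / δ)) with hM
    have hM1 : 1 ≤ M := le_max_left _ _
    rw [← ENNReal.ofReal_mul (by positivity)]
    set A := {ω | ENNReal.ofReal (Real.exp (2 * M)) ≤ Osborne.expCost K ε μ (fun t => k t ω)}
      with hA
    have hAm : MeasurableSet A := measurableSet_le measurable_const hmeas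
    have hPA : P A ≤ ENNReal.ofReal δ := by
      have h1 := (mul_meas_ge_le_lintegral (μ := P) hmeas
        (ENNReal.ofReal (Real.exp (2 * M)))).trans hE
      have h2 : (2 : ℝ≥0∞) ≤ ENNReal.ofReal (Real.exp (2 * M)) * ENNReal.ofReal δ := by
        rw [show (2 : ℝ≥0∞) = ENNReal.ofReal 2 by simp, ← ENNReal.ofReal_mul (Real.exp_pos _).le]
        refine ENNReal.ofReal_le_ofReal ?_
        have h3 : 1 / δ ≤ Real.exp M :=
          (Real.log_le_iff_le_exp (by positivity)).1 (le_max_right _ _)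
        rw [div_le_iff₀ hδ] at h3
        have h4 : 2 ≤ Real.exp M := by linarith [Real.add_one_le_exp M]
        rw [two_mul M, Real.exp_add, mul_assoc]
        nlinarith
      exact (ENNReal.mul_le_mul_iff_right (ENNReal.ofReal_pos.2 (Real.exp_pos _)).ne'
        ENNReal.ofReal_ne_top).1 (h1.trans h2)
    calc ENNReal.ofReal (1 - δ) = 1 - ENNReal.ofReal δ := by
          rw [ENNReal.ofReal_sub _ hδ.le, ENNReal.ofReal_one]
      _ ≤ 1 - P A := tsub_le_tsub_left hPA 1
      _ = P Aᶜ := (prob_compl_eq_one_sub hAm).symm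
      _ ≤ _ := by
          refine measure_mono fun ω hω => ?_
          by_contra hlt
          have h := Osborne.exp_lt_expCost_of_lt_totalOps h0 hμ (not_le.1 hlt)
          rw [show μ * (2 / μ * M) = 2 * M by field_simp] at h
          exact hω h.le
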